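/- **Setting.** Let $\mathcal M=(V,\{A_i\}_{i\in V},P)$ be a Markov decision process with a finite set of states $V$ ($|V|=n$), a finite nonempty set $A_i$ of actions at each state $i$ (an uncontrolled state has a single action), and transition probabilities $P(i,a,j)$. A control policy chooses at each time an action admissible at the current state as a function of the states visited so far; it is stationary if the choice depends on the current state only. Let $S\subseteq V$. All actions have cost $1$. Let $C(N)$ be the number of cycles up to time $N$: the first cycle starts at time $0$, and each visit to $S$ at a time $1\le k\le N$ ends the current cycle and starts a new one, so that $C(N)=1+|\{1\le k\le N: X_k\in S\}|$. The average cost per cycle (ACPC) of the policy $\mu$ from the initial state $s$ is $$J_\mu(s)=\limsup_{N\to\infty}\mathbf E_{\mu,s}\left[\frac{N+1}{C(N)}\right]\in[0,\infty].$$ For a class $\mathcal P$ of policies, the minimum ACPC from $s$ over $\mathcal P$ is $\inf_{\mu\in\mathcal P}J_\mu(s)$. **Theorem.** Let $\lambda\in\mathbb R$, and suppose that for every $h\in\mathbb R^{V}$ there exist a state $i$ and an action $a\in A_i$ such that $$\lambda\,\mathbf 1\{i\in S\}+h(i)-\sum_{j\in V}P(i,a,j)\,h(j)>1 .$$ Then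 the ACPC is bounded above by $\lambda$, in the following sense. 1. If $\mathcal P$ is a class of policies that contains all stationary policies (for instance, all stationary policies, or all control policies), and if the minimum ACPC over $\mathcal P$ does not depend on the initial state, then it is at most $\lambda$. 2. If $\mathcal M$ is communicating (every state can be reached from every other state under a suitable choice of actions), then there is a stationary policy $\mu$ such that for every initial state $s$ both $J_\mu(s)\le\lambda$ and, almost surely, $\limsup_{N\to\infty} N/C(N)\le\lambda$. 3. Without any further assumption, there are a stationary policy $\mu$ and an initial state $s$ such that $J_\mu(s)\le\lambda$ and, almost surely under $\mu$ from $s$, $\limsup_{N\to\infty}N/C(N)\le\lambda$. -/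

import Mathlib

open MeasureTheory ProbabilityTheory Filter
open scoped ENNReal

noncomputable section

/-- A Markov decision process with states `V` and action sets `A i`: playing `a : A i` in state `i`,
the next state has distribution `trans i a`, so `P(i, a, j) = trans i a j`. An uncontrolled state is
one with a single action. -/
structure MDP (V : Type*) (A : V → Type*) where
  trans : (i : V) → A i → PMF V

/-- Sequences of states visited at times `0, …, n`. -/
abbrev StateHistory (V : Type*) (n : ℕ) : Type _ := (_ : Finset.Iic n) → V

/-- The state at time `n`, the last one of a history up to time `n`. -/
def StateHistory.current {V : Type*} {n : ℕ} (x : StateHistory V n) : V :=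
  x ⟨n, Finset.mem_Iic.2 le_rfl⟩

/-- A (history-dependent) control policy picks an admissible action at the current state from the
sequence of states visited so far. -/
abbrev ControlPolicy {V : Type*} (A : V → Type*) : Type _ :=
  (n : ℕ) → (x : StateHistory V n) → A x.current

/-- A stationary policy picks an admissible action from the current state alone. -/
abbrev StationaryPolicy {V : Type*} (A : V → Type*) : Type _ := (i : V) → A i

/-- A stationary policy, seen as a control policy. -/
def StationaryPolicy.toControl {V : Type*} {A : V → Type*} (μ : StationaryPolicy A) :
    ControlPolicy A :=
  fun _ x => μ x.current

/-- The number of cycles up to time `N` along the path `x`: the first cycle starts at time `0`, and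
each later visit to `S` (at a time `1 ≤ k ≤ N`) ends the current cycle and starts a new one. -/
def cycleCount {V : Type*} (S : Set V) (x : ℕ → V) (N : ℕ) : ℕ :=
  1 + ∑ k ∈ Finset.Icc 1 N, S.indicator 1 (x k)

namespace MDP

variable {V : Type*} {A : V → Type*}

/-- Every state can be reached from every state, under a suitable choice of actions. -/
def Communicating (M : MDP V A) : Prop :=
  ∀ i j : V, Relation.ReflTransGen (fun i' j' => ∃ a : A i', 0 < M.trans i' a j') i j

variable [Fintype V] [MeasurableSpace V] [MeasurableSingletonClass V]

/-- The conditional law of the state at time `n + 1` given the states up to time `n`, under `μ`. -/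
def stepKernel (M : MDP V A) (μ : ControlPolicy A) (n : ℕ) : Kernel (StateHistory V n) V :=
  Kernel.ofFunOfCountable fun x => (M.trans x.current (μ n x)).toMeasure

instance (M : MDP V A) (μ : ControlPolicy A) (n : ℕ) : IsMarkovKernel (M.stepKernel μ n) :=
  ⟨fun x => inferInstanceAs (IsProbabilityMeasure (M.trans x.current (μ n x)).toMeasure)⟩

/-- The law of the process `X₀, X₁, X₂, …` controlled by `μ` and started at `X₀ = s`. -/
def pathMeasure (M : MDP V A) (μ : ControlPolicy A) (s : V) : Measure (ℕ → V) :=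
  Kernel.traj (X := fun _ => V) (M.stepKernel μ) 0 (fun _ => s)

/-- The average cost per cycle of `μ` from the initial state `s`, when all actions have cost `1` (so
that the cost accumulated at times `0, …, N` is `N + 1`), as an extended nonnegative real. -/
def ACPC (M : MDP V A) (S : Set V) (μ : ControlPolicy A) (s : V) : ℝ≥0∞ :=
  limsup (fun N : ℕ => ∫⁻ x, ((N + 1 : ℕ) : ℝ≥0∞) / (cycleCount S x N : ℝ≥0∞) ∂(M.pathMeasure μ s))
    atTop

/-- The optimal average cost per cycle from `s` over the policies in the class `Pol`. -/
def minACPC (M : MDP V A) (S : Set V) (Pol : Set (ControlPolicy A)) (s : V) : ℝ≥0∞ :=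
  ⨅ μ ∈ Pol, M.ACPC S μ s

/-- From the initial state `s`, the policy `μ` has average cost per cycle at most `c`, both in
expectation and almost surely along paths. -/
def ACPCBounded (M : MDP V A) (S : Set V) (μ : ControlPolicy A) (s : V) (c : ℝ≥0∞) : Prop :=
  M.ACPC S μ s ≤ c ∧
    ∀ᵐ x ∂(M.pathMeasure μ s),
      limsup (fun N : ℕ => (N : ℝ≥0∞) / (cycleCount S x N : ℝ≥0∞)) atTop ≤ c

end MDP

end

/-! Put c = λ·1_S − 1. The hypothesis says that no potential h satisfies c + h − Ph ≤ 0 at every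
state-action pair. Two minimality arguments turn this failure into an inequality of the opposite
sign. `exists_policy_no_potential` shrinks the action sets, keeping the failure, until a single
stationary policy μ is left. `exists_absorbing_potential` then finds, for the chain of μ, an
absorbing set C and a potential h with c + h − Ph ≥ 0 on C.

From a start in C, the reward sum ∑ c(X_k) + h(X_0) − h(X_N) is a submartingale with bounded
increments. A Chernoff bound makes a linear deficit exponentially unlikely
(`exists_exponential_bound`). As the rewards sum to about λC(N) − N, the ratio N/C(N) exceeds λ + ε
only with exponentially small probability, which gives the bounds in mean and almost surely.

If the process communicates, μ is modified off C so that C is reached from everywhere, and a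
Dirichlet problem extends h to all of V. -/

/-! ### Averages against a finite distribution. -/

namespace PMF

variable {V : Type*} [Fintype V]

/-- The expected value of `h` under `p`. -/
def mean (p : PMF V) (h : V → ℝ) : ℝ := ∑ j, (p j).toReal * h j

lemma sum_toReal (p : PMF V) : ∑ j, (p j).toReal = 1 := by
  have h := p.tsum_coe
  rw [tsum_fintype] at h
  rw [← ENNReal.toReal_sum (fun j _ => p.apply_ne_top j), h, ENNReal.toReal_one]

lemma mean_const (p : PMF V) (k : ℝ) : p.mean (fun _ => k) = k := by
  simp [mean, ← Finset.sum_mul, p.sum_toReal]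

lemma mean_add (p : PMF V) (f g : V → ℝ) : p.mean (fun j => f j + g j) = p.mean f + p.mean g := by
  simp [mean, mul_add, Finset.sum_add_distrib]

lemma mean_smul (p : PMF V) (k : ℝ) (f : V → ℝ) : p.mean (fun j => k * f j) = k * p.mean f := by
  simp only [mean, Finset.mul_sum]
  exact Finset.sum_congr rfl fun j _ => by ring

lemma mean_congr (p : PMF V) {f g : V → ℝ} (h : ∀ j, p j ≠ 0 → f j = g j) :
    p.mean f = p.mean g := by
  refine Finset.sum_congr rfl fun j _ => ?_
  by_cases hj : p j = 0
  · simp [hj]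
  · rw [h j hj]

lemma mean_mono (p : PMF V) {f g : V → ℝ} (h : ∀ j, f j ≤ g j) : p.mean f ≤ p.mean g :=
  Finset.sum_le_sum fun j _ => mul_le_mul_of_nonneg_left (h j) ENNReal.toReal_nonneg

/-- If the mean of `h` reaches an upper bound of `h`, then `h` equals this bound on the support. -/
lemma eq_of_le_mean (p : PMF V) {h : V → ℝ} {m : ℝ} (hm : ∀ j, h j ≤ m) (hp : m ≤ p.mean h)
    {j : V} (hj : p j ≠ 0) : h j = m := by
  by_contra hne
  have hlt : h j < m := lt_of_le_of_ne (hm j) hne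
  have hpos : 0 < (p j).toReal := ENNReal.toReal_pos hj (p.apply_ne_top j)
  have : p.mean h < p.mean (fun _ => m) :=
    Finset.sum_lt_sum (fun k _ => mul_le_mul_of_nonneg_left (hm k) ENNReal.toReal_nonneg)
      ⟨j, Finset.mem_univ j, mul_lt_mul_of_pos_left hlt hpos⟩
  rw [mean_const] at this
  linarith

end PMF

/-! ### Finite Markov chains: absorbing sets, Dirichlet problems, potentials. -/

/-- A set of states which the Markov chain with transition laws `q` cannot leave. -/
def AbsorbingSet {V : Type*} (q : V → PMF V) (C : Set V) : Prop :=
  ∀ i ∈ C, ∀ j, q i j ≠ 0 → j ∈ C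

/-- A set that meets every nonempty absorbing set. -/
def MeetsAbsorbing {V : Type*} (q : V → PMF V) (D : Set V) : Prop :=
  ∀ C : Set V, C.Nonempty → AbsorbingSet q C → (C ∩ D).Nonempty

section Chain

variable {V : Type*} [Fintype V]

/-- Maximum principle. -/
lemma nonpos_of_subharmonic {q : V → PMF V} {D : Set V} (hD : MeetsAbsorbing q D) {f : V → ℝ}
    (hf : ∀ i ∉ D, f i ≤ (q i).mean f) (hf0 : ∀ i ∈ D, f i ≤ 0) (i : V) : f i ≤ 0 := by
  classical
  have : Nonempty V := ⟨i⟩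
  obtain ⟨m, hm⟩ := Finite.exists_max f
  refine (hm i).trans ?_
  by_contra! hpos
  -- A positive maximum is attained only off `D`, where subharmonicity spreads it to all successors;
  -- the set of maximizers is thus absorbing and must meet `D`.
  obtain ⟨k, hk, hkD⟩ := hD {k | f k = f m} ⟨m, rfl⟩ fun k (hk : f k = f m) j hj => by
    have hkD : k ∉ D := fun h => by linarith [hf0 k h]
    exact (q k).eq_of_le_mean hm (hk ▸ hf k hkD) hj
  have hk' : f k = f m := hk
  linarith [hf0 k hkD]

/-- The Dirichlet problem `h - P h = c` off `D`, `h = b` on `D` has a solution as soon as `D` meets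
every absorbing set. -/
lemma exists_dirichlet {q : V → PMF V} {D : Set V} (hD : MeetsAbsorbing q D) (c b : V → ℝ) :
    ∃ h : V → ℝ, (∀ i ∉ D, h i - (q i).mean h = c i) ∧ ∀ i ∈ D, h i = b i := by
  classical
  -- In finite dimension uniqueness gives existence; the maximum principle applied to `f` and `-f`
  -- makes `L` injective.
  let L : (V → ℝ) →ₗ[ℝ] (V → ℝ) :=
    { toFun := fun f i => if i ∈ D then f i else f i - (q i).mean f
      map_add' := fun f g => by
        funext i
        have := (q i).mean_add f g
        by_cases hi : i ∈ D
        · simp [hi]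
        · simp only [hi, if_false, Pi.add_apply]
          rw [show f + g = fun j => f j + g j from rfl, this]; ring
      map_smul' := fun k f => by
        funext i
        have := (q i).mean_smul k f
        by_cases hi : i ∈ D
        · simp [hi]
        · simp only [hi, if_false, Pi.smul_apply, smul_eq_mul, RingHom.id_apply]
          rw [show k • f = fun j => k * f j from rfl, this]; ring }
  have hle : ∀ f, L f = 0 → ∀ i, f i ≤ 0 := fun f hf => by
    refine nonpos_of_subharmonic hD (fun i hi => ?_) (fun i hi => ?_)
    · have := congrFun hf i
      simp only [L, LinearMap.coe_mk, AddHom.coe_mk, hi, if_false, Pi.zero_apply] at this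
      linarith
    · have := congrFun hf i
      simp only [L, LinearMap.coe_mk, AddHom.coe_mk, hi, if_true, Pi.zero_apply] at this
      exact this.le
  have hinj : Function.Injective L := by
    rw [← LinearMap.ker_eq_bot, LinearMap.ker_eq_bot']
    intro f hf
    funext i
    have h1 := hle f hf i
    have h2 := hle (-f) (by rw [map_neg, hf, neg_zero]) i
    simp only [Pi.neg_apply] at h2
    exact le_antisymm h1 (show (0 : ℝ) ≤ f i by linarith)
  obtain ⟨h, hh⟩ := (LinearMap.injective_iff_surjective.1 hinj) fun i => if i ∈ D then b i else c i
  refine ⟨h, fun i hi => ?_, fun i hi => ?_⟩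
  · simpa [L, hi] using congrFun hh i
  · simpa [L, hi] using congrFun hh i

/-- If the rewards `c` admit no potential `h` with `c + h - P h ≤ 0`, there is an absorbing set on
which some potential satisfies `c + h - P h ≥ 0`. -/
lemma exists_absorbing_potential {q : V → PMF V} {c : V → ℝ}
    (hc : ∀ h : V → ℝ, ∃ i, 0 < c i + h i - (q i).mean h) :
    ∃ (C : Set V) (h : V → ℝ), C.Nonempty ∧ AbsorbingSet q C ∧
      ∀ i ∈ C, 0 ≤ c i + h i - (q i).mean h := by
  classical
  obtain ⟨D, hD⟩ := (Set.toFinite {D : Set V | MeetsAbsorbing q D}).exists_minimal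
    ⟨Set.univ, fun C hC _ => by simpa using hC⟩
  obtain ⟨h, hoff, hon⟩ := exists_dirichlet hD.prop (fun i => -c i) (fun _ => 0)
  obtain ⟨d, hd⟩ := hc h
  have hdD : d ∈ D := by
    by_contra hdD
    have := hoff d hdD
    linarith
  -- By minimality of `D`, some absorbing set meets `D` at most in `d`: on it the expression
  -- vanishes off `d` and is positive at `d`.
  have hnot : ¬ MeetsAbsorbing q (D \ {d}) := fun hm =>
    (hD.le_of_le hm Set.sdiff_subset hdD).2 rfl
  simp only [MeetsAbsorbing, not_forall] at hnot
  obtain ⟨C, hne, hC, hCD⟩ := hnot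
  refine ⟨C, h, hne, hC, fun i hi => ?_⟩
  by_cases hid : i = d
  · exact hid ▸ hd.le
  · have : i ∉ D := fun hiD => hCD ⟨i, hi, hiD, hid⟩
    linarith [hoff i this]

end Chain

/-! ### Reduction to one stationary policy. -/

namespace MDP

variable {V : Type*} [Fintype V] {A : V → Type*}

/-- If no potential `h` satisfies `c + h - P h ≤ 0` for all actions, then this already holds for the
actions of some stationary policy. -/
lemma exists_policy_no_potential [∀ i, Fintype (A i)] [∀ i, Nonempty (A i)] (M : MDP V A)
    {c : V → ℝ} (hc : ∀ h : V → ℝ, ∃ i a, 0 < c i + h i - (M.trans i a).mean h) :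
    ∃ μ : StationaryPolicy A, ∀ h : V → ℝ, ∃ i, 0 < c i + h i - (M.trans i (μ i)).mean h := by
  classical
  obtain ⟨B, hB⟩ := (Set.toFinite {B : (i : V) → Finset (A i) | (∀ i, (B i).Nonempty) ∧
      ∀ h : V → ℝ, ∃ i, ∃ a ∈ B i, 0 < c i + h i - (M.trans i a).mean h}).exists_minimal
    ⟨fun _ => Finset.univ, fun _ => Finset.univ_nonempty, by simpa using hc⟩
  choose μ hμ using hB.prop.1
  have hsub : ∀ i, ∀ a ∈ B i, a = μ i := by
    intro i a ha
    by_contra hne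
    -- Shrinking `B i` to a proper part `E` destroys the property, so a potential appears. Adding a
    -- constant changes no inequality and allows `h i = 0`.
    have key : ∀ E ⊆ B i, E.Nonempty → E ≠ B i →
        ∃ h : V → ℝ, h i = 0 ∧ (∀ a ∈ E, c i + h i - (M.trans i a).mean h ≤ 0) ∧
          ∀ j ≠ i, ∀ a ∈ B j, c j + h j - (M.trans j a).mean h ≤ 0 := by
      intro E hE hEne hEB
      have hnot : ¬ ∀ h : V → ℝ, ∃ j, ∃ a ∈ Function.update B i E j,
          0 < c j + h j - (M.trans j a).mean h := by
        intro hH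
        have hle : Function.update B i E ≤ B := by
          intro j
          by_cases hj : j = i
          · subst hj; simpa using hE
          · simp [hj]
        have := hB.le_of_le ⟨fun j => ?_, hH⟩ hle i
        · simp only [Function.update_self] at this
          exact hEB (Finset.Subset.antisymm hE this)
        · by_cases hj : j = i
          · subst hj; simpa using hEne
          · simpa [hj] using hB.prop.1 j
      push Not at hnot
      obtain ⟨h, hh⟩ := hnot
      have hshift : ∀ j a, (M.trans j a).mean (fun k => h k + -h i)
          = (M.trans j a).mean h + -h i := fun j a => by
        rw [PMF.mean_add, PMF.mean_const]
      refine ⟨fun k => h k + -h i, by ring, fun a ha => ?_, fun j hj a ha => ?_⟩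
      · rw [hshift]
        linarith [hh i a (by simpa using ha)]
      · rw [hshift]
        linarith [hh j a (by simpa [hj] using ha)]
    obtain ⟨h₁, hi₁, hE₁, ho₁⟩ := key {a} (by simpa using ha) (by simp) fun h => by
      have := h ▸ hμ i
      simp only [Finset.mem_singleton] at this
      exact hne this.symm
    obtain ⟨h₂, hi₂, hE₂, ho₂⟩ := key ((B i).erase a) (Finset.erase_subset _ _)
      ⟨μ i, by simp [hμ i, Ne.symm hne]⟩ fun h => by
        have := h ▸ ha
        simp at this
    -- The maximum of the two potentials works for all of `B`: its mean dominates both means, and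
    -- its value at `j` is attained by one of them, or by both at `i`, where they agree.
    obtain ⟨j, b, hb, hpos⟩ := hB.prop.2 fun k => max (h₁ k) (h₂ k)
    have hm₁ := (M.trans j b).mean_mono fun k => le_max_left (h₁ k) (h₂ k)
    have hm₂ := (M.trans j b).mean_mono fun k => le_max_right (h₁ k) (h₂ k)
    by_cases hj : j = i
    · subst hj
      rw [hi₁, hi₂, max_self] at hpos
      by_cases hba : b = a
      · have := hE₁ b (by simp [hba])
        linarith
      · have := hE₂ b (by simp [hba, hb])
        linarith
    · have e₁ := ho₁ j hj b hb
      have e₂ := ho₂ j hj b hb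
      rcases max_cases (h₁ j) (h₂ j) with ⟨h, -⟩ | ⟨h, -⟩ <;> rw [h] at hpos <;> linarith
  refine ⟨μ, fun h => ?_⟩
  obtain ⟨i, a, ha, hpos⟩ := hB.prop.2 h
  exact ⟨i, hsub i a ha ▸ hpos⟩

end MDP

/-! ### Steering a communicating process into a set. -/

namespace MDP

variable {V : Type*} {A : V → Type*}

/-- In a communicating process, a policy can be changed off a nonempty set `C` so that `C` is reached
from everywhere. -/
lemma Communicating.exists_policy_meets [Finite V] {M : MDP V A} (hM : M.Communicating)
    (μ : StationaryPolicy A) {C : Set V} (hC : C.Nonempty) :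
    ∃ ν : StationaryPolicy A, (∀ i ∈ C, ν i = μ i) ∧
      MeetsAbsorbing (fun i => M.trans i (ν i)) C := by
  classical
  -- `K` is required to be closed only at its states in `W`, so that actions outside `W` stay free
  -- and `W` can grow by one state at a time.
  obtain ⟨W, hW⟩ := (Set.toFinite {W : Set V | C ⊆ W ∧ ∃ ν : StationaryPolicy A,
      (∀ i ∈ C, ν i = μ i) ∧ ∀ K : Set V, (K ∩ W).Nonempty →
        (∀ i ∈ K ∩ W, ∀ j, M.trans i (ν i) j ≠ 0 → j ∈ K) → (K ∩ C).Nonempty}).exists_maximal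
    ⟨C, subset_rfl, μ, fun _ _ => rfl, fun K hK _ => hK⟩
  obtain ⟨hCW, ν, hν, hK⟩ := hW.prop
  have hWuniv : W = Set.univ := by
    by_contra hne
    obtain ⟨t, ht⟩ := (Set.ne_univ_iff_exists_notMem W).1 hne
    obtain ⟨s, hs⟩ := hC
    have hcross : ∃ i ∉ W, ∃ a : A i, ∃ j ∈ W, M.trans i a j ≠ 0 := by
      by_contra! hno
      have : ∀ k, Relation.ReflTransGen
          (fun i' j' => ∃ a : A i', 0 < M.trans i' a j') t k → k ∉ W := by
        intro k hk
        induction hk with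
        | refl => exact ht
        | tail _ hstep ih =>
          obtain ⟨a, ha⟩ := hstep
          exact fun hmem => ha.ne' (hno _ ih a _ hmem)
      exact this s (hM t s) (hCW hs)
    obtain ⟨i, hi, a, j, hj, hpos⟩ := hcross
    have hup : ∀ k ∈ W, Function.update ν i a k = ν k := fun k hk =>
      Function.update_of_ne (fun h : k = i => hi (h ▸ hk)) _ _
    refine hi (hW.le_of_ge (y := insert i W) ⟨hCW.trans (Set.subset_insert _ _),
      Function.update ν i a, fun k hk => (hup k (hCW hk)).trans (hν k hk),
      fun K hKne hcl => ?_⟩ (Set.subset_insert _ _) (Set.mem_insert i W))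
    refine hK K ?_ fun k hk l hl => hcl k ⟨hk.1, Or.inr hk.2⟩ l (by rwa [hup k hk.2])
    obtain ⟨k, hkK, rfl | hkW⟩ := hKne
    · exact ⟨j, hcl k ⟨hkK, Or.inl rfl⟩ j (by rwa [Function.update_self]), hj⟩
    · exact ⟨k, hkK, hkW⟩
  subst hWuniv
  exact ⟨ν, hν, fun K hne habs => hK K (by simpa using hne) fun i hi j hj => habs i hi.1 j hj⟩

end MDP

/-! ### The path measure under a stationary policy. -/

namespace MDP

variable {V : Type*} [Fintype V] [MeasurableSpace V] [MeasurableSingletonClass V] {A : V → Type*}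

instance (M : MDP V A) (μ : ControlPolicy A) (s : V) : IsProbabilityMeasure (M.pathMeasure μ s) :=
  inferInstanceAs (IsProbabilityMeasure (Kernel.traj (X := fun _ => V) (M.stepKernel μ) 0 _))

lemma pathMeasure_ae_zero (M : MDP V A) (μ : ControlPolicy A) (s : V) :
    ∀ᵐ x ∂(M.pathMeasure μ s), x 0 = s := by
  have h := Kernel.traj_map_frestrictLe_apply (X := fun _ => V) (κ := M.stepKernel μ) 0 0
    (fun _ => s)
  rw [Kernel.partialTraj_self, Kernel.id_apply] at h
  have hmeas : MeasurableSet {u : StateHistory V 0 | u.current = s} := Set.Countable.measurableSet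
    (Set.to_countable _)
  have : ∀ᵐ u ∂((M.pathMeasure μ s).map (Preorder.frestrictLe 0)),
      StateHistory.current u = s := by
    rw [pathMeasure, h, ae_dirac_iff hmeas]
    rfl
  exact ae_of_ae_map (by fun_prop) this

/-- The Markov property at time `n`, for a stationary policy. -/
lemma lintegral_pathMeasure_succ (M : MDP V A) (μ : StationaryPolicy A) (s : V) (n : ℕ)
    {G : (ℕ → V) → ℝ≥0∞} (hG : ∀ x y : ℕ → V, (∀ k ≤ n, x k = y k) → G x = G y)
    (k : V → V → ℝ≥0∞) :
    ∫⁻ x, G x * k (x n) (x (n + 1)) ∂(M.pathMeasure μ.toControl s) =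
      ∫⁻ x, G x * ∑ j, M.trans (x n) (μ (x n)) j * k (x n) j ∂(M.pathMeasure μ.toControl s) := by
  -- Padding a history arbitrarily after time `n` does not affect `G`, which can thus be integrated
  -- over histories.
  let ext : StateHistory V n → ℕ → V := fun u i =>
    if hi : i ≤ n then u ⟨i, Finset.mem_Iic.2 hi⟩ else s
  have hext : ∀ x : ℕ → V, G (ext (Preorder.frestrictLe n x)) = G x := fun x => by
    refine hG _ _ fun i hi => ?_
    simp [ext, hi]
  have hcur : ∀ x : ℕ → V, StateHistory.current (Preorder.frestrictLe n x) = x n := fun x => rfl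
  have hmap := Kernel.partialTraj_compProd_eq_map_traj (X := fun _ => V)
    (κ := M.stepKernel μ.toControl) (Nat.zero_le n) (x₀ := fun _ => s)
  have hpart := Kernel.traj_map_frestrictLe_apply (X := fun _ => V)
    (κ := M.stepKernel μ.toControl) 0 n (fun _ => s)
  let F : StateHistory V n × V → ℝ≥0∞ := fun p => G (ext p.1) * k p.1.current p.2
  have hF : Measurable F := measurable_of_countable F
  have hstep : ∀ u : StateHistory V n, ∫⁻ j, F (u, j) ∂(M.stepKernel μ.toControl n u) =
      G (ext u) * ∑ j, M.trans u.current (μ u.current) j * k u.current j := by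
    intro u
    rw [lintegral_fintype, Finset.mul_sum]
    refine Finset.sum_congr rfl fun j _ => ?_
    have : (M.stepKernel μ.toControl n u) {j} = M.trans u.current (μ u.current) j :=
      PMF.toMeasure_apply_singleton _ _ (measurableSet_singleton j)
    rw [this]
    simp only [F]
    ring
  calc ∫⁻ x, G x * k (x n) (x (n + 1)) ∂(M.pathMeasure μ.toControl s)
      = ∫⁻ x, F (Preorder.frestrictLe n x, x (n + 1)) ∂(M.pathMeasure μ.toControl s) := by
        refine lintegral_congr fun x => ?_
        simp only [F, hext, hcur]
    _ = ∫⁻ p, F p ∂((M.pathMeasure μ.toControl s).map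
          fun x => (Preorder.frestrictLe n x, x (n + 1))) := by
        rw [lintegral_map hF (by fun_prop)]
    _ = ∫⁻ u : StateHistory V n, G (ext u) * ∑ j, M.trans u.current (μ u.current) j * k u.current j
          ∂((M.pathMeasure μ.toControl s).map (Preorder.frestrictLe n)) := by
        rw [pathMeasure, ← hmap, Measure.lintegral_compProd hF, hpart]
        exact lintegral_congr hstep
    _ = _ := by
        rw [lintegral_map (measurable_of_countable _) (by fun_prop)]
        refine lintegral_congr fun x => ?_
        rw [hext, hcur]

/-- Absorbing sets are not left. -/
lemma pathMeasure_ae_mem (M : MDP V A) (μ : StationaryPolicy A) {C : Set V}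
    (hC : AbsorbingSet (fun i => M.trans i (μ i)) C) {s : V} (hs : s ∈ C) (n : ℕ) :
    ∀ᵐ x ∂(M.pathMeasure μ.toControl s), x n ∈ C := by
  induction n with
  | zero =>
    filter_upwards [M.pathMeasure_ae_zero μ.toControl s] with x hx
    rwa [hx]
  | succ n ih =>
    have h := M.lintegral_pathMeasure_succ μ s n (G := fun _ => 1) (fun _ _ _ => rfl)
      fun _ j => Cᶜ.indicator 1 j
    have h0 : ∫⁻ x, 1 * ∑ j, M.trans (x n) (μ (x n)) j * Cᶜ.indicator 1 j
        ∂(M.pathMeasure μ.toControl s) = 0 := by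
      rw [← lintegral_zero (μ := M.pathMeasure μ.toControl s)]
      refine lintegral_congr_ae ?_
      filter_upwards [ih] with x hx
      rw [one_mul]
      refine Finset.sum_eq_zero fun j _ => ?_
      by_cases hj : j ∈ C
      · simp [hj]
      · have : M.trans (x n) (μ (x n)) j = 0 := by
          by_contra hne
          exact hj (hC _ hx j hne)
        simp [this]
    have hmeas : Measurable (Cᶜ.indicator (1 : V → ℝ≥0∞)) := measurable_of_countable _
    rw [h0, lintegral_eq_zero_iff (by fun_prop)] at h
    filter_upwards [h] with x hx
    by_contra hne
    simp [hne] at hx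

end MDP

/-! ### Exponential moments of the reward sums. -/

lemma PMF.mean_exp_le {V : Type*} [Fintype V] (p : PMF V) {y : V → ℝ} {b θ : ℝ} (hθ : 0 ≤ θ)
    (hb : ∀ j, |y j| ≤ b) (hθb : θ * b ≤ 1) (hy : 0 ≤ p.mean y) :
    p.mean (fun j => Real.exp (-θ * y j)) ≤ Real.exp (b ^ 2 * θ ^ 2) := by
  -- For |u| ≤ 1, exp u ≤ 1 + u + u²; the linear term has nonpositive mean.
  have h1 : ∀ j, Real.exp (-θ * y j) ≤ (1 + b ^ 2 * θ ^ 2) + -θ * y j := fun j => by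
    have habs : |-θ * y j| ≤ θ * b := by
      rw [abs_mul, abs_neg, abs_of_nonneg hθ]
      exact mul_le_mul_of_nonneg_left (hb j) hθ
    have h2 := (abs_le.1 (Real.abs_exp_sub_one_sub_id_le (habs.trans hθb))).2
    have h3 : (-θ * y j) ^ 2 ≤ (θ * b) ^ 2 := sq_le_sq' (abs_le.1 habs).1 (abs_le.1 habs).2
    nlinarith
  have h4 := p.mean_mono h1
  rw [PMF.mean_add, PMF.mean_const, PMF.mean_smul] at h4
  nlinarith [Real.add_one_le_exp (b ^ 2 * θ ^ 2), mul_nonneg hθ hy]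

namespace MDP

variable {V : Type*} [Fintype V] [MeasurableSpace V] [MeasurableSingletonClass V] {A : V → Type*}

/-- Exponential moment bound for the rewards accumulated on an absorbing set that carries a
potential. -/
lemma lintegral_exp_le (M : MDP V A) (μ : StationaryPolicy A) {C : Set V}
    (hC : AbsorbingSet (fun i => M.trans i (μ i)) C) {c h : V → ℝ}
    (hh : ∀ i ∈ C, 0 ≤ c i + h i - (M.trans i (μ i)).mean h) {b θ : ℝ} (hθ : 0 ≤ θ)
    (hb : ∀ i j, |c i + h i - h j| ≤ b) (hθb : θ * b ≤ 1) {s : V} (hs : s ∈ C) (N : ℕ) :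
    ∫⁻ x, ENNReal.ofReal (Real.exp (-θ * (∑ k ∈ Finset.range N, c (x k) + h (x 0) - h (x N))))
      ∂(M.pathMeasure μ.toControl s) ≤ ENNReal.ofReal (Real.exp (b ^ 2 * θ ^ 2)) ^ N := by
  induction N with
  | zero => simp
  | succ N ih =>
    let G : (ℕ → V) → ℝ≥0∞ := fun x =>
      ENNReal.ofReal (Real.exp (-θ * (∑ k ∈ Finset.range N, c (x k) + h (x 0) - h (x N))))
    let k : V → V → ℝ≥0∞ := fun i j => ENNReal.ofReal (Real.exp (-θ * (c i + h i - h j)))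
    have hG : ∀ x y : ℕ → V, (∀ k ≤ N, x k = y k) → G x = G y := fun x y hxy => by
      have : ∑ k ∈ Finset.range N, c (x k) = ∑ k ∈ Finset.range N, c (y k) :=
        Finset.sum_congr rfl fun i hi => by rw [hxy i (Finset.mem_range.1 hi).le]
      simp only [G, this, hxy 0 (Nat.zero_le _), hxy N le_rfl]
    have hk : ∀ i ∈ C, ∑ j, M.trans i (μ i) j * k i j ≤
        ENNReal.ofReal (Real.exp (b ^ 2 * θ ^ 2)) := by
      intro i hi
      have hmean : 0 ≤ (M.trans i (μ i)).mean fun j => c i + h i - h j := by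
        have h1 := (M.trans i (μ i)).mean_add (fun _ => c i + h i) (fun j => -1 * h j)
        rw [PMF.mean_const, PMF.mean_smul] at h1
        have h2 : (fun j => c i + h i - h j) = fun j => c i + h i + -1 * h j := by
          funext j; ring
        rw [h2, h1]
        linarith [hh i hi]
      refine le_trans (le_of_eq ?_)
        (ENNReal.ofReal_le_ofReal ((M.trans i (μ i)).mean_exp_le hθ (hb i) hθb hmean))
      rw [PMF.mean, ENNReal.ofReal_sum_of_nonneg fun j _ => by positivity]
      refine Finset.sum_congr rfl fun j _ => ?_
      rw [ENNReal.ofReal_mul ENNReal.toReal_nonneg, ENNReal.ofReal_toReal (PMF.apply_ne_top _ _)]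
    calc _ = ∫⁻ x, G x * k (x N) (x (N + 1)) ∂(M.pathMeasure μ.toControl s) := by
          refine lintegral_congr fun x => ?_
          simp only [G, k]
          rw [← ENNReal.ofReal_mul (Real.exp_nonneg _), ← Real.exp_add, Finset.sum_range_succ]
          congr 2
          ring
      _ = ∫⁻ x, G x * ∑ j, M.trans (x N) (μ (x N)) j * k (x N) j
            ∂(M.pathMeasure μ.toControl s) := M.lintegral_pathMeasure_succ μ s N hG k
      _ ≤ ∫⁻ x, G x * ENNReal.ofReal (Real.exp (b ^ 2 * θ ^ 2))
            ∂(M.pathMeasure μ.toControl s) := by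
          refine lintegral_mono_ae ?_
          filter_upwards [M.pathMeasure_ae_mem μ hC hs N] with x hx
          exact mul_le_mul_right (hk _ hx) _
      _ ≤ _ := by
          rw [lintegral_mul_const' _ _ ENNReal.ofReal_ne_top, pow_succ]
          exact mul_le_mul_left ih _

end MDP

/-! ### Cycle counts: large deviations and the cost bounds. -/

lemma one_le_cycleCount {V : Type*} (S : Set V) (x : ℕ → V) (N : ℕ) : 1 ≤ cycleCount S x N :=
  Nat.le_add_right _ _

/-- The leading 1 in `cycleCount` pays for a possible visit to `S` at time 0. -/
lemma sum_indicator_le_cycleCount {V : Type*} (S : Set V) (x : ℕ → V) (N : ℕ) :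
    ∑ k ∈ Finset.range N, S.indicator (fun _ => (1 : ℝ)) (x k) ≤ cycleCount S x N := by
  classical
  have h : ∑ k ∈ Finset.range N, S.indicator (1 : V → ℕ) (x k) ≤ cycleCount S x N := by
    calc ∑ k ∈ Finset.range N, S.indicator (1 : V → ℕ) (x k)
        ≤ ∑ k ∈ insert 0 (Finset.Icc 1 N), S.indicator (1 : V → ℕ) (x k) := by
          refine Finset.sum_le_sum_of_subset fun k hk => ?_
          rw [Finset.mem_range] at hk
          rw [Finset.mem_insert, Finset.mem_Icc]
          omega
      _ = S.indicator 1 (x 0) + ∑ k ∈ Finset.Icc 1 N, S.indicator (1 : V → ℕ) (x k) :=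
          Finset.sum_insert (by simp)
      _ ≤ cycleCount S x N := by
          refine Nat.add_le_add_right ?_ _
          by_cases h0 : x 0 ∈ S <;> simp [h0]
  refine le_trans (le_of_eq ?_) (Nat.cast_le.2 h)
  rw [Nat.cast_sum]
  refine Finset.sum_congr rfl fun k _ => ?_
  by_cases hk : x k ∈ S <;> simp [hk]

lemma measurable_cycleCount {V : Type*} [Finite V] [MeasurableSpace V] [MeasurableSingletonClass V]
    (S : Set V) (N : ℕ) : Measurable fun x : ℕ → V => cycleCount S x N := by
  have h : Measurable (S.indicator (1 : V → ℕ)) := measurable_of_countable _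
  unfold cycleCount
  fun_prop

namespace MDP

variable {V : Type*} [Fintype V] [MeasurableSpace V] [MeasurableSingletonClass V] {A : V → Type*}

/-- If an absorbing set carries a potential for the rewards `lam * 1_S - 1`, then paths with less
than `N / (lam + ε)` cycles are exponentially unlikely. -/
lemma exists_exponential_bound (M : MDP V A) (S : Set V) (μ : StationaryPolicy A) {C : Set V}
    (hC : AbsorbingSet (fun i => M.trans i (μ i)) C) {lam : ℝ} (hlam : 0 ≤ lam) {h : V → ℝ}
    (hh : ∀ i ∈ C,
      0 ≤ lam * S.indicator (fun _ => (1 : ℝ)) i - 1 + h i - (M.trans i (μ i)).mean h)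
    {s : V} (hs : s ∈ C) {ε : ℝ} (hε : 0 < ε) :
    ∃ K ρ : ℝ, 0 ≤ K ∧ 0 ≤ ρ ∧ ρ < 1 ∧ ∀ N : ℕ, M.pathMeasure μ.toControl s
      {x | (lam + ε) * cycleCount S x N < N + 1} ≤ ENNReal.ofReal (K * ρ ^ N) := by
  set c : V → ℝ := fun i => lam * S.indicator (fun _ => (1 : ℝ)) i - 1 with hc
  obtain ⟨b, hb1, hbh, hbc⟩ : ∃ b : ℝ, 0 < b ∧ (∀ i j, |h i - h j| ≤ b) ∧
      ∀ i j, |c i + h i - h j| ≤ b := by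
    have H : ∀ i, |h i| ≤ ∑ j, |h j| := fun i =>
      Finset.single_le_sum (f := fun j => |h j|) (fun j _ => abs_nonneg _) (Finset.mem_univ i)
    have H' : ∀ i, |c i| ≤ ∑ j, |c j| := fun i =>
      Finset.single_le_sum (f := fun j => |c j|) (fun j _ => abs_nonneg _) (Finset.mem_univ i)
    have Hc : 0 ≤ ∑ j, |c j| := Finset.sum_nonneg fun _ _ => abs_nonneg _
    have Hh : 0 ≤ ∑ j, |h j| := Finset.sum_nonneg fun _ _ => abs_nonneg _
    refine ⟨1 + ∑ j, |c j| + 2 * ∑ j, |h j|, by positivity, fun i j => ?_, fun i j => ?_⟩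
    · have h1 := abs_le.1 (H i)
      have h2 := abs_le.1 (H j)
      exact abs_le.2 ⟨by linarith, by linarith⟩
    · have h1 := abs_le.1 (H i)
      have h2 := abs_le.1 (H j)
      have h3 := abs_le.1 (H' i)
      exact abs_le.2 ⟨by linarith, by linarith⟩
  -- Since λ/(λ+ε) = 1 − δ, too few cycles force a reward deficit of about δN. In `θ`, the first
  -- bound allows the quadratic estimate of exp and the second keeps b²θ² below half of the linear
  -- gain θδ.
  set δ : ℝ := ε / (lam + ε) with hδ
  have hlε : 0 < lam + ε := by linarith
  have hδ0 : 0 < δ := div_pos hε hlε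
  set θ : ℝ := min (1 / b) (δ / (2 * b ^ 2)) with hθ
  have hθ0 : 0 < θ := lt_min (by positivity) (by positivity)
  have hθb : θ * b ≤ 1 := by
    rw [← le_div_iff₀ hb1]
    exact min_le_left _ _
  have hθδ : b ^ 2 * θ ^ 2 ≤ θ * δ / 2 := by
    have : θ * (2 * b ^ 2) ≤ δ := by
      rw [← le_div_iff₀ (by positivity)]
      exact min_le_right _ _
    nlinarith
  refine ⟨Real.exp (θ * (1 + b)), Real.exp (-(θ * δ / 2)), (Real.exp_pos _).le,
    (Real.exp_pos _).le, by
      rw [← Real.exp_zero]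
      exact Real.exp_lt_exp.2 (by linarith [mul_pos hθ0 hδ0]), fun N => ?_⟩
  set f : (ℕ → V) → ℝ≥0∞ := fun x =>
    ENNReal.ofReal (Real.exp (-θ * (∑ k ∈ Finset.range N, c (x k) + h (x 0) - h (x N)))) with hf
  have hfmeas : Measurable f := by
    have hcm : Measurable c := measurable_of_countable _
    have hhm : Measurable h := measurable_of_countable _
    fun_prop
  set t : ℝ := Real.exp (θ * (δ * N - 1 - b)) with ht
  have hsub : {x | (lam + ε) * cycleCount S x N < N + 1} ⊆ {x | ENNReal.ofReal t ≤ f x} := by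
    intro x hx
    have hx' : (lam + ε) * (cycleCount S x N : ℝ) < N + 1 := hx
    refine ENNReal.ofReal_le_ofReal (Real.exp_le_exp.2 ?_)
    have h1 : ∑ k ∈ Finset.range N, c (x k) ≤ lam * cycleCount S x N - N := by
      simp only [hc, Finset.sum_sub_distrib, ← Finset.mul_sum, Finset.sum_const, Finset.card_range,
        nsmul_eq_mul, mul_one]
      linarith [mul_le_mul_of_nonneg_left (sum_indicator_le_cycleCount S x N) hlam]
    have h2 : (cycleCount S x N : ℝ) ≤ (N + 1) / (lam + ε) := by
      rw [le_div_iff₀ hlε]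
      linarith
    have h3 : lam * ((N + 1) / (lam + ε)) = (1 - δ) * (N + 1) := by
      rw [hδ]; field_simp; ring
    have h4 := mul_le_mul_of_nonneg_left h2 hlam
    have h5 := (abs_le.1 (hbh (x 0) (x N))).2
    have h6 : ∑ k ∈ Finset.range N, c (x k) + h (x 0) - h (x N) ≤ -(δ * N - 1 - b) := by
      nlinarith
    have := mul_le_mul_of_nonneg_left h6 hθ0.le
    linarith
  have ht0 : ENNReal.ofReal t ≠ 0 := by simpa using Real.exp_pos _
  calc M.pathMeasure μ.toControl s {x | (lam + ε) * cycleCount S x N < N + 1}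
      ≤ M.pathMeasure μ.toControl s {x | ENNReal.ofReal t ≤ f x} := measure_mono hsub
    _ ≤ (∫⁻ x, f x ∂(M.pathMeasure μ.toControl s)) / ENNReal.ofReal t :=
        meas_ge_le_lintegral_div hfmeas.aemeasurable ht0 ENNReal.ofReal_ne_top
    _ ≤ ENNReal.ofReal (Real.exp (b ^ 2 * θ ^ 2)) ^ N / ENNReal.ofReal t :=
        ENNReal.div_le_div_right (M.lintegral_exp_le μ hC hh hθ0.le hbc hθb hs N) _
    _ = ENNReal.ofReal (Real.exp (N * (b ^ 2 * θ ^ 2) - θ * (δ * N - 1 - b))) := by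
        rw [← ENNReal.ofReal_pow (Real.exp_nonneg _), ← ENNReal.ofReal_div_of_pos (Real.exp_pos _),
          ← Real.exp_nat_mul, ← Real.exp_sub]
    _ ≤ _ := by
        rw [← Real.exp_nat_mul, ← Real.exp_add]
        refine ENNReal.ofReal_le_ofReal (Real.exp_le_exp.2 ?_)
        have := mul_le_mul_of_nonneg_left hθδ (Nat.cast_nonneg (α := ℝ) N)
        nlinarith

lemma div_cycleCount_le {V : Type*} {S : Set V} {x : ℕ → V} {N : ℕ} {r : ℝ}
    (h : ((N : ℝ) + 1) ≤ r * cycleCount S x N) :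
    ((N + 1 : ℕ) : ℝ≥0∞) / (cycleCount S x N : ℝ≥0∞) ≤ ENNReal.ofReal r := by
  have hpos : 0 < cycleCount S x N := one_le_cycleCount S x N
  have h' : ((N + 1 : ℕ) : ℝ) ≤ r * cycleCount S x N := by push_cast; exact h
  rw [ENNReal.div_le_iff (by exact_mod_cast hpos.ne') (ENNReal.natCast_ne_top _),
    ← ENNReal.ofReal_natCast, ← ENNReal.ofReal_natCast (cycleCount S x N),
    ← ENNReal.ofReal_mul' (Nat.cast_nonneg _)]
  exact ENNReal.ofReal_le_ofReal h'

/-- If an absorbing set carries a potential for the rewards `lam * 1_S - 1`, the average cost per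
cycle is at most `lam` from each of its states. -/
lemma acpcBounded_of_potential (M : MDP V A) (S : Set V) (μ : StationaryPolicy A) {C : Set V}
    (hC : AbsorbingSet (fun i => M.trans i (μ i)) C) {lam : ℝ} {h : V → ℝ}
    (hh : ∀ i ∈ C,
      0 ≤ lam * S.indicator (fun _ => (1 : ℝ)) i - 1 + h i - (M.trans i (μ i)).mean h)
    {s : V} (hs : s ∈ C) : M.ACPCBounded S μ.toControl s (ENNReal.ofReal lam) := by
  have hlam : 0 ≤ lam := by
    -- Where `h` is minimal on the absorbing set, h − Ph ≤ 0, so λ·1_S ≥ 1 there. Hence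
    -- `ENNReal.ofReal lam` truncates nothing.
    obtain ⟨i, hi, hmin⟩ := C.toFinite.exists_minimalFor h C ⟨s, hs⟩
    have hle : h i ≤ (M.trans i (μ i)).mean h := by
      have := (M.trans i (μ i)).mean_mono fun j => min_le_right (h i) (h j)
      rw [PMF.mean_congr (g := fun _ => h i) _ fun j hj => ?_, PMF.mean_const] at this
      · exact this
      · rcases le_total (h i) (h j) with hij | hij
        · exact min_eq_left hij
        · exact min_eq_left (hmin (hC i hi j hj) hij)
    have := hh i hi
    by_cases hiS : i ∈ S
    · rw [Set.indicator_of_mem hiS] at this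
      linarith
    · rw [Set.indicator_of_notMem hiS] at this
      linarith
  have hbad := fun ε (hε : (0 : ℝ) < ε) => M.exists_exponential_bound S μ hC hlam hh hs hε
  constructor
  · have key : ∀ ε : ℝ, 0 < ε → M.ACPC S μ.toControl s ≤ ENNReal.ofReal (lam + ε) := by
      intro ε hε
      obtain ⟨K, ρ, hK, hρ, hρ1, hb⟩ := hbad ε hε
      have hmeas : ∀ N : ℕ, MeasurableSet {x | (lam + ε) * cycleCount S x N < N + 1} := fun N =>
        measurableSet_lt (((measurable_of_countable (Nat.cast : ℕ → ℝ)).comp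
          (measurable_cycleCount S N)).const_mul _) measurable_const
      have hint : ∀ N : ℕ, ∫⁻ x, ((N + 1 : ℕ) : ℝ≥0∞) / (cycleCount S x N : ℝ≥0∞)
          ∂(M.pathMeasure μ.toControl s) ≤
          ENNReal.ofReal (lam + ε) + ENNReal.ofReal ((N + 1) * (K * ρ ^ N)) := by
        intro N
        -- On the rare event the ratio is still at most N + 1, which the exponential decay absorbs.
        calc _ ≤ ∫⁻ x, (ENNReal.ofReal (lam + ε) +
              {x | (lam + ε) * cycleCount S x N < N + 1}.indicator
                (fun _ => ((N + 1 : ℕ) : ℝ≥0∞)) x) ∂(M.pathMeasure μ.toControl s) := by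
              refine lintegral_mono fun x => ?_
              by_cases hx : x ∈ {x | (lam + ε) * cycleCount S x N < N + 1}
              · rw [Set.indicator_of_mem hx]
                refine le_trans ?_ le_add_self
                refine ENNReal.div_le_of_le_mul (le_mul_of_one_le_right zero_le ?_)
                exact_mod_cast one_le_cycleCount S x N
              · exact (div_cycleCount_le (not_lt.1 hx)).trans le_self_add
          _ = ENNReal.ofReal (lam + ε) + ((N + 1 : ℕ) : ℝ≥0∞) * M.pathMeasure μ.toControl s
                {x | (lam + ε) * cycleCount S x N < N + 1} := by
              rw [lintegral_add_left measurable_const, lintegral_const, measure_univ, mul_one,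
                lintegral_indicator_const (hmeas N)]
          _ ≤ _ := by
              rw [ENNReal.ofReal_mul (by positivity)]
              have : ENNReal.ofReal ((N : ℝ) + 1) = ((N + 1 : ℕ) : ℝ≥0∞) := by
                rw [← ENNReal.ofReal_natCast]; push_cast; rfl
              rw [this]
              gcongr
              exact hb N
      have hlim : Tendsto (fun N : ℕ => ENNReal.ofReal (lam + ε) +
          ENNReal.ofReal (((N : ℝ) + 1) * (K * ρ ^ N))) atTop
          (nhds (ENNReal.ofReal (lam + ε))) := by
        have h1 := tendsto_self_mul_const_pow_of_lt_one hρ hρ1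
        have h2 := tendsto_pow_atTop_nhds_zero_of_lt_one hρ hρ1
        have h3 := ENNReal.tendsto_ofReal ((h1.add h2).const_mul K)
        have h4 := h3.const_add (ENNReal.ofReal (lam + ε))
        simp only [add_zero, mul_zero, ENNReal.ofReal_zero] at h4
        refine h4.congr fun N => ?_
        congr 2
        ring
      rw [ACPC, ← hlim.limsup_eq]
      exact limsup_le_limsup (Eventually.of_forall hint)
    have hlim : Tendsto (fun m : ℕ => ENNReal.ofReal (lam + 1 / ((m : ℝ) + 1))) atTop
        (nhds (ENNReal.ofReal lam)) := by
      have := ENNReal.tendsto_ofReal (tendsto_one_div_add_atTop_nhds_zero_nat.const_add lam)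
      rwa [add_zero] at this
    exact ge_of_tendsto' hlim fun m => key _ Nat.one_div_pos_of_nat
  · have key : ∀ m : ℕ, ∀ᵐ x ∂(M.pathMeasure μ.toControl s),
        limsup (fun N : ℕ => (N : ℝ≥0∞) / (cycleCount S x N : ℝ≥0∞)) atTop ≤
          ENNReal.ofReal (lam + 1 / ((m : ℝ) + 1)) := by
      intro m
      obtain ⟨K, ρ, hK, hρ, hρ1, hb⟩ := hbad _ (Nat.one_div_pos_of_nat (n := m))
      have hsum : ∑' N : ℕ, M.pathMeasure μ.toControl s
          {x | (lam + 1 / ((m : ℝ) + 1)) * cycleCount S x N < N + 1} ≠ ⊤ :=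
        ne_top_of_le_ne_top
          ((summable_geometric_of_lt_one hρ hρ1).mul_left K).tsum_ofReal_ne_top
          (ENNReal.tsum_le_tsum hb)
      filter_upwards [ae_eventually_notMem hsum] with x hx
      refine limsup_le_of_le (by isBoundedDefault) ?_
      filter_upwards [hx] with N hN
      refine le_trans ?_ (div_cycleCount_le (not_lt.1 hN))
      gcongr
      exact Nat.le_succ N
    have hlim : Tendsto (fun m : ℕ => ENNReal.ofReal (lam + 1 / ((m : ℝ) + 1))) atTop
        (nhds (ENNReal.ofReal lam)) := by
      have := ENNReal.tendsto_ofReal (tendsto_one_div_add_atTop_nhds_zero_nat.const_add lam)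
      rwa [add_zero] at this
    filter_upwards [ae_all_iff.2 key] with x hx
    exact ge_of_tendsto' hlim hx

end MDP

/-! ### Assembly of the three claims. -/

theorem mainTheorem6 {V : Type*} [Fintype V] [MeasurableSpace V] [MeasurableSingletonClass V]
    {A : V → Type*} [∀ i, Fintype (A i)] [∀ i, Nonempty (A i)]
    (M : MDP V A) (S : Set V) (lam : ℝ)
    (hlam : ∀ h : V → ℝ, ∃ (i : V) (a : A i),
      lam * S.indicator (fun _ => (1 : ℝ)) i + h i - ∑ j, (M.trans i a j).toReal * h j > 1) :
    (∀ Pol : Set (ControlPolicy A), Set.range StationaryPolicy.toControl ⊆ Pol →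
      (∀ s t : V, M.minACPC S Pol s = M.minACPC S Pol t) →
      ∀ s : V, M.minACPC S Pol s ≤ ENNReal.ofReal lam) ∧
    (M.Communicating →
      ∃ μ : StationaryPolicy A, ∀ s : V, M.ACPCBounded S μ.toControl s (ENNReal.ofReal lam)) ∧
    (∃ (μ : StationaryPolicy A) (s : V),
      M.ACPCBounded S μ.toControl s (ENNReal.ofReal lam)) := by
  obtain ⟨μ, hμ⟩ := M.exists_policy_no_potential
    (c := fun i => lam * S.indicator (fun _ => (1 : ℝ)) i - 1) fun h => by
      obtain ⟨i, a, hia⟩ := hlam h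
      exact ⟨i, a, by rw [PMF.mean]; linarith⟩
  obtain ⟨C, h, hne, hC, hh⟩ := exists_absorbing_potential hμ
  refine ⟨fun Pol hPol hconst s => ?_, fun hM => ?_, ?_⟩
  · obtain ⟨t, ht⟩ := hne
    rw [hconst s t]
    exact (iInf₂_le _ (hPol ⟨μ, rfl⟩)).trans (M.acpcBounded_of_potential S μ hC hh ht).1
  · obtain ⟨ν, hν, hmeets⟩ := hM.exists_policy_meets μ hne
    -- The extension `g` gives equality off `C`. On `C` the old inequality persists, since `ν` plays
    -- as `μ` there and the chain only moves within `C`, where g = h.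
    obtain ⟨g, hg, hgC⟩ := exists_dirichlet hmeets
      (fun i => 1 - lam * S.indicator (fun _ => (1 : ℝ)) i) h
    refine ⟨ν, fun s => M.acpcBounded_of_potential S ν (C := Set.univ) (h := g)
      (fun _ _ _ _ => Set.mem_univ _) (fun i _ => ?_) (Set.mem_univ s)⟩
    by_cases hi : i ∈ C
    · have hmean : (M.trans i (ν i)).mean g = (M.trans i (μ i)).mean h := by
        rw [hν i hi]
        exact PMF.mean_congr _ fun j hj => hgC j (hC i hi j hj)
      rw [hmean, hgC i hi]
      exact hh i hi
    · linarith [hg i hi]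
  · obtain ⟨t, ht⟩ := hne
    exact ⟨μ, t, M.acpcBounded_of_potential S μ hC hh ht⟩
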